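/- A weight sequence is a sequence $(M_n)_{n\ge 0}$ of positive real numbers with $M_0=1$ and $\dfrac{M_{n+m}}{M_nM_m}\ge\dbinom{n+m}{m}$ for all integers $n,m\ge 0$. For a compact interval $X\subset\mathbb{R}$ of positive length let $$D(X,M)=\Big\{f\in C^\infty(X;\mathbb{C}) : \|f\|_D=\sum_{n=0}^\infty \frac{\|f^{(n)}\|_\infty}{M_n}<\infty\Big\},$$ an algebra under pointwise operations with norm $\|\cdot\|_D$ (derivatives at the end points of $X$ are one-sided, and $\|\cdot\|_\infty$ is the supremum over $X$). A map $\varphi:X\to X$ induces an endomorphism of $D(X,M)$ if $f\circ\varphi\in D(X,M)$ for every $f\in D(X,M)$; the endomorphism is then $f\mapsto f\circ\varphi$. **Theorem 1.1.** Let $X$ be a compact interval of positive length and let $(M_n)$ be a weight sequence. Suppose that $\varphi:X\to X$ induces an endomorphism of $D(X,M)$ which is a compact operator, and let $x_0\in X$ be a fixed point of $\varphi$. Then $\varphi$ is differentiable at $x_0$ and $|\varphi'(x_0)|<1$. -/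

import Mathlib

/-- A weight sequence: positive reals with `M 0 = 1` and
`M (n + m) / (M n * M m) ≥ (n + m).choose m` for all `n`, `m`. -/
structure WeightSequence where
  M : ℕ → ℝ
  pos : ∀ n, 0 < M n
  zero : M 0 = 1
  choose_le : ∀ n m, ((n + m).choose m : ℝ) ≤ M (n + m) / (M n * M m)

namespace WeightedSmooth

open Set (Icc IccExtend)
open scoped ContDiff

variable {a b : ℝ}

/-- The `n`-th derivative of a complex function on `X = [a, b]` (one-sided at the end points).
`IccExtend` only serves to view `f` as a function on `ℝ`: derivatives are taken within `[a, b]`. -/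
noncomputable def derivX (hab : a < b) (n : ℕ) (f : Icc a b → ℂ) (x : Icc a b) : ℂ :=
  iteratedDerivWithin n (IccExtend hab.le f) (Icc a b) x

/-- The uniform norm of the `n`-th derivative over `[a, b]`. -/
noncomputable def supDeriv (hab : a < b) (n : ℕ) (f : Icc a b → ℂ) : ℝ :=
  ⨆ x : Icc a b, ‖derivX hab n f x‖

/-- `f` is infinitely differentiable on `[a, b]`. -/
def Smooth (hab : a < b) (f : Icc a b → ℂ) : Prop :=
  ContDiffOn ℝ ∞ (IccExtend hab.le f) (Icc a b)

/-- Membership in `D(X, M)`: `f` is smooth on `X = [a, b]` and `∑ ‖f⁽ⁿ⁾‖_∞ / M n < ∞`. -/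
def MemD (hab : a < b) (W : WeightSequence) (f : Icc a b → ℂ) : Prop :=
  Smooth hab f ∧ Summable fun n => supDeriv hab n f / W.M n

/-- The norm `∑ ‖f⁽ⁿ⁾‖_∞ / M n`. -/
noncomputable def normD (hab : a < b) (W : WeightSequence) (f : Icc a b → ℂ) : ℝ :=
  ∑' n, supDeriv hab n f / W.M n

section aux

variable (hab : a < b) (W : WeightSequence) {f g : Icc a b → ℂ}

theorem Smooth.within (hf : Smooth hab f) (n : ℕ) (x : Icc a b) :
    ContDiffWithinAt ℝ n (IccExtend hab.le f) (Icc a b) x :=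
  (hf x x.2).of_le (by exact_mod_cast le_top)

theorem supDeriv_nonneg (n : ℕ) (f : Icc a b → ℂ) : 0 ≤ supDeriv hab n f :=
  Real.iSup_nonneg fun _ => norm_nonneg _

theorem term_nonneg (n : ℕ) (f : Icc a b → ℂ) : 0 ≤ supDeriv hab n f / W.M n :=
  div_nonneg (supDeriv_nonneg hab n f) (W.pos n).le

theorem le_supDeriv (hf : Smooth hab f) (n : ℕ) (x : Icc a b) :
    ‖derivX hab n f x‖ ≤ supDeriv hab n f := by
  have hc : ContinuousOn (iteratedDerivWithin n (IccExtend hab.le f) (Icc a b)) (Icc a b) :=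
    ContDiffOn.continuousOn_iteratedDerivWithin hf (by exact_mod_cast le_top)
      (uniqueDiffOn_Icc hab)
  obtain ⟨C, hC⟩ := isCompact_Icc.exists_bound_of_continuousOn hc
  refine le_ciSup (f := fun x : Icc a b => ‖derivX hab n f x‖) ⟨C, ?_⟩ x
  rintro _ ⟨y, rfl⟩
  exact hC y y.2

theorem supDeriv_le {n : ℕ} {C : ℝ} (h : ∀ x, ‖derivX hab n f x‖ ≤ C) :
    supDeriv hab n f ≤ C := by
  have : Nonempty (Icc a b) := ⟨⟨a, Set.left_mem_Icc.2 hab.le⟩⟩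
  exact ciSup_le h

theorem supDeriv_add_le (hf : Smooth hab f) (hg : Smooth hab g) (n : ℕ) :
    supDeriv hab n (f + g) ≤ supDeriv hab n f + supDeriv hab n g := by
  refine supDeriv_le hab fun x => ?_
  have : derivX hab n (f + g) x = derivX hab n f x + derivX hab n g x :=
    iteratedDerivWithin_add x.2 (uniqueDiffOn_Icc hab) (hf.within hab n x) (hg.within hab n x)
  rw [this]
  exact (norm_add_le _ _).trans (add_le_add (le_supDeriv hab hf n x) (le_supDeriv hab hg n x))

theorem supDeriv_smul (c : ℂ) (f : Icc a b → ℂ) (n : ℕ) :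
    supDeriv hab n (c • f) = ‖c‖ * supDeriv hab n f := by
  have : ∀ x, ‖derivX hab n (c • f) x‖ = ‖c‖ * ‖derivX hab n f x‖ := fun x => by
    rw [← norm_mul]
    exact congrArg norm
      (iteratedDerivWithin_const_smul_field (s := Icc a b) (x := (x : ℝ)) c (IccExtend hab.le f))
  simp only [supDeriv, this]
  rw [Real.mul_iSup_of_nonneg (norm_nonneg c)]

theorem supDeriv_mul_le (hf : Smooth hab f) (hg : Smooth hab g) (n : ℕ) :
    supDeriv hab n (f * g) ≤ ∑ p ∈ Finset.HasAntidiagonal.antidiagonal n,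
      (n.choose p.1 : ℝ) * (supDeriv hab p.1 f * supDeriv hab p.2 g) := by
  refine supDeriv_le hab fun x => ?_
  have h : derivX hab n (f * g) x = ∑ i ∈ Finset.range (n + 1),
      (n.choose i : ℂ) * derivX hab i f x * derivX hab (n - i) g x :=
    iteratedDerivWithin_mul x.2 (uniqueDiffOn_Icc hab) (hf.within hab n x) (hg.within hab n x)
  rw [h, Finset.Nat.sum_antidiagonal_eq_sum_range_succ_mk]
  refine (norm_sum_le _ _).trans (Finset.sum_le_sum fun i _ => ?_)
  rw [norm_mul, norm_mul, Complex.norm_natCast, mul_assoc]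
  gcongr
  · exact supDeriv_nonneg hab _ _
  · exact le_supDeriv hab hf _ x
  · exact le_supDeriv hab hg _ x

theorem term_mul_le (hf : Smooth hab f) (hg : Smooth hab g) (n : ℕ) :
    supDeriv hab n (f * g) / W.M n ≤ ∑ p ∈ Finset.HasAntidiagonal.antidiagonal n,
      (supDeriv hab p.1 f / W.M p.1) * (supDeriv hab p.2 g / W.M p.2) := by
  rw [div_le_iff₀ (W.pos n), Finset.sum_mul]
  refine (supDeriv_mul_le hab hf hg n).trans (Finset.sum_le_sum fun p hp => ?_)
  have hn : p.2 + p.1 = n := by rw [add_comm]; exact Finset.HasAntidiagonal.mem_antidiagonal.1 hp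
  have h := W.choose_le p.2 p.1
  rw [hn, le_div_iff₀ (mul_pos (W.pos _) (W.pos _))] at h
  have h1 := W.pos p.1
  have h2 := W.pos p.2
  have h0 : 0 ≤ (supDeriv hab p.1 f / W.M p.1) * (supDeriv hab p.2 g / W.M p.2) :=
    mul_nonneg (term_nonneg hab W _ _) (term_nonneg hab W _ _)
  calc (n.choose p.1 : ℝ) * (supDeriv hab p.1 f * supDeriv hab p.2 g)
      = (supDeriv hab p.1 f / W.M p.1) * (supDeriv hab p.2 g / W.M p.2)
        * (n.choose p.1 * (W.M p.2 * W.M p.1)) := by field_simp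
    _ ≤ _ := mul_le_mul_of_nonneg_left h h0

theorem MemD.add (hf : MemD hab W f) (hg : MemD hab W g) : MemD hab W (f + g) := by
  refine ⟨ContDiffOn.add hf.1 hg.1,
    (hf.2.add hg.2).of_nonneg_of_le (term_nonneg hab W · _) fun n => ?_⟩
  rw [← add_div]
  exact div_le_div_of_nonneg_right (supDeriv_add_le hab hf.1 hg.1 n) (W.pos n).le

theorem summable_prod (hf : MemD hab W f) (hg : MemD hab W g) :
    Summable fun n => ∑ p ∈ Finset.HasAntidiagonal.antidiagonal n,
      (supDeriv hab p.1 f / W.M p.1) * (supDeriv hab p.2 g / W.M p.2) :=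
  summable_sum_mul_antidiagonal_of_summable_mul (f := fun n => supDeriv hab n f / W.M n)
    (g := fun n => supDeriv hab n g / W.M n)
    (Summable.mul_of_nonneg hf.2 hg.2 (fun n => term_nonneg hab W n f)
      (fun n => term_nonneg hab W n g))

theorem MemD.mul (hf : MemD hab W f) (hg : MemD hab W g) : MemD hab W (f * g) :=
  ⟨ContDiffOn.mul hf.1 hg.1, (summable_prod hab W hf hg).of_nonneg_of_le
    (term_nonneg hab W · _) (term_mul_le hab W hf.1 hg.1)⟩

theorem memD_const (c : ℂ) : MemD hab W (fun _ => c) := by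
  have hE : IccExtend hab.le (fun _ : Icc a b => c) = fun _ => c := rfl
  refine ⟨by rw [Smooth, hE]; exact contDiffOn_const,
    summable_of_ne_finset_zero (s := {0}) fun n hn => ?_⟩
  have hn0 : n ≠ 0 := by simpa using hn
  have : supDeriv hab n (fun _ : Icc a b => c) = 0 := by
    simp [supDeriv, derivX, hE, iteratedDerivWithin_const, hn0]
  rw [this, zero_div]

end aux

/-- `D(X, M)` as a subalgebra of the algebra of all functions `X → ℂ`
(pointwise operations). -/
def subalg (hab : a < b) (W : WeightSequence) : Subalgebra ℂ (Icc a b → ℂ) where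
  carrier := {f | MemD hab W f}
  mul_mem' := MemD.mul hab W
  add_mem' := MemD.add hab W
  algebraMap_mem' := memD_const hab W

/-- The algebra `D(X, M)`, `X = [a, b]`. It is a separate type so that it carries the topology of
its own norm and not the topology of pointwise convergence. -/
def D (hab : a < b) (W : WeightSequence) : Type := subalg hab W

section alg

variable (hab : a < b) (W : WeightSequence)

noncomputable instance : CommRing (D hab W) := inferInstanceAs (CommRing (subalg hab W))

noncomputable instance : Algebra ℂ (D hab W) := inferInstanceAs (Algebra ℂ (subalg hab W))

/-- The underlying function on `[a, b]` of an element of `D(X, M)`. -/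
def D.fn {hab : a < b} {W : WeightSequence} (f : D hab W) : Icc a b → ℂ := f.1

theorem normD_nonneg (f : Icc a b → ℂ) : 0 ≤ normD hab W f :=
  tsum_nonneg (term_nonneg hab W · f)

theorem normD_smul (c : ℂ) (f : Icc a b → ℂ) : normD hab W (c • f) = ‖c‖ * normD hab W f := by
  simp only [normD, supDeriv_smul, mul_div_assoc, tsum_mul_left]

/-- `∑ ‖f⁽ⁿ⁾‖_∞ / M n` is an algebra norm on `D(X, M)`. -/
noncomputable def ringNorm : RingNorm (D hab W) where
  toFun f := normD hab W f.fn
  map_zero' := by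
    have h := normD_smul hab W 0 (0 : Icc a b → ℂ)
    rw [smul_zero, norm_zero, zero_mul] at h
    exact h
  add_le' f g := by
    have hf : MemD hab W f.fn := f.2
    have hg : MemD hab W g.fn := g.2
    change normD hab W (f.fn + g.fn) ≤ _
    unfold normD
    rw [← hf.2.tsum_add hg.2]
    refine (hf.add hab W hg).2.tsum_le_tsum (fun n => ?_) (hf.2.add hg.2)
    rw [← add_div]
    exact div_le_div_of_nonneg_right (supDeriv_add_le hab hf.1 hg.1 n) (W.pos n).le
  neg' f := by
    have h := normD_smul hab W (-1) f.fn
    rw [norm_neg, norm_one, one_mul, neg_one_smul] at h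
    exact h
  mul_le' f g := by
    have hf : MemD hab W f.fn := f.2
    have hg : MemD hab W g.fn := g.2
    change normD hab W (f.fn * g.fn) ≤ normD hab W f.fn * normD hab W g.fn
    unfold normD
    rw [hf.2.tsum_mul_tsum_eq_tsum_sum_antidiagonal hg.2
      (hf.2.mul_of_nonneg hg.2 (term_nonneg hab W · f.fn) (term_nonneg hab W · g.fn))]
    exact (hf.mul hab W hg).2.tsum_le_tsum (term_mul_le hab W hf.1 hg.1)
      (summable_prod hab W hf hg)
  eq_zero_of_map_eq_zero' f h := by
    have hf : MemD hab W f.fn := f.2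
    have h0 : supDeriv hab 0 f.fn / W.M 0 ≤ normD hab W f.fn :=
      hf.2.le_tsum 0 fun n _ => term_nonneg hab W n _
    rw [W.zero, div_one] at h0
    apply Subtype.ext
    funext x
    have hx := (le_supDeriv hab hf.1 0 x).trans (h0.trans h.le)
    have hx0 : derivX hab 0 f.fn x = f.fn x := by
      simp [derivX]
    rw [hx0] at hx
    exact norm_le_zero_iff.1 hx

noncomputable instance : NormedCommRing (D hab W) :=
  { (ringNorm hab W).toNormedRing with mul_comm := mul_comm }

theorem norm_def (f : D hab W) : ‖f‖ = ∑' n, supDeriv hab n f.fn / W.M n := rfl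

noncomputable instance : NormedAlgebra ℂ (D hab W) where
  norm_smul_le c f := (normD_smul hab W c f.fn).le

/-- A self-map `φ` of `X` induces an endomorphism of `D(X, M)`: `f ∘ φ ∈ D(X, M)` whenever
`f ∈ D(X, M)`. -/
def InducesEnd (φ : Icc a b → Icc a b) : Prop :=
  ∀ f : Icc a b → ℂ, MemD hab W f → MemD hab W (f ∘ φ)

/-- The endomorphism `f ↦ f ∘ φ` of the algebra `D(X, M)`. -/
noncomputable def inducedEnd {φ : Icc a b → Icc a b} (hφ : InducesEnd hab W φ) :
    D hab W →ₐ[ℂ] D hab W where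
  toFun f := ⟨f.fn ∘ φ, hφ f.fn f.2⟩
  map_one' := rfl
  map_mul' _ _ := rfl
  map_zero' := rfl
  map_add' _ _ := rfl
  commutes' _ := rfl

end alg

end WeightedSmooth

/-! Write T for the endomorphism and V n for the functions vanishing to order n at the fixed point.
The V n are closed, because derivatives at a point are continuous functionals, and strictly
decreasing, because of the powers of y - x₀. By the leading term of Faà di Bruno's formula, T
preserves V n and acts on V n / V (n + 1) as multiplication by φ'(x₀)^n. If |φ'(x₀)| ≥ 1, Riesz's
lemma gives unit vectors, one in each V n, whose images under T are 1/2-separated, which contradicts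
compactness. Neither completeness of D(X, M) nor spectral theory is needed. Smoothness of φ follows
since the coordinate function lies in D(X, M). -/

/-! ### Compact operators and decreasing chains of invariant subspaces -/

open Filter Topology in
/-- If `T` is a compact operator, `V` a strictly decreasing sequence of closed `T`-invariant
subspaces and `T` acts on `V n ⧸ V (n + 1)` as multiplication by `μ ^ n`, then `‖μ‖ < 1`. -/
theorem IsCompactOperator.norm_lt_one_of_strictAnti {𝕜 E : Type*} [RCLike 𝕜]
    [NormedAddCommGroup E] [NormedSpace 𝕜 E] {T : E →ₗ[𝕜] E} (hT : IsCompactOperator T)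
    {V : ℕ → Submodule 𝕜 E} (hV : StrictAnti V) (hclosed : ∀ n, IsClosed (V n : Set E))
    (hinv : ∀ n, ∀ f ∈ V n, T f ∈ V n) {μ : 𝕜}
    (hμ : ∀ n, ∀ f ∈ V n, T f - μ ^ n • f ∈ V (n + 1)) : ‖μ‖ < 1 := by
  by_contra! hle
  -- Riesz's lemma inside V n, for its proper closed subspace V (n + 1).
  have hex : ∀ n, ∃ f ∈ V n, ‖f‖ = 1 ∧ ∀ g ∈ V (n + 1), 1 / 2 ≤ ‖f - g‖ := fun n => by
    obtain ⟨y, hy, hy'⟩ := SetLike.exists_of_lt (hV n.lt_succ_self)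
    have hc : IsClosed (((V (n + 1)).comap (V n).subtype : Submodule 𝕜 (V n)) : Set (V n)) :=
      (hclosed (n + 1)).preimage continuous_subtype_val
    obtain ⟨f, -, hf1, hf⟩ := riesz_lemma_of_lt_one hc ⟨⟨y, hy⟩, hy'⟩
      (show (1 / 2 : ℝ) < 1 by norm_num)
    exact ⟨f, f.2, hf1, fun g hg => hf ⟨g, hV.antitone n.le_succ hg⟩ hg⟩
  choose f hfV hf1 hfd using hex
  -- T (f m) - T (f n) is μ ^ m times f m minus an element of V (m + 1), so its norm is at least ‖μ‖
  -- ^ m / 2.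
  have hsep : ∀ m n, m < n → 1 / 2 ≤ dist (T (f m)) (T (f n)) := fun m n hmn => by
    have hpos : 0 < ‖μ ^ m‖ := by
      rw [norm_pow]
      exact pow_pos (one_pos.trans_le hle) m
    have h0 : μ ^ m ≠ 0 := norm_pos_iff.1 hpos
    have hmem : T (f m) - μ ^ m • f m - T (f n) ∈ V (m + 1) :=
      sub_mem (hμ m _ (hfV m)) (hV.antitone hmn (hinv n _ (hfV n)))
    have hd := hfd m _ ((V (m + 1)).smul_mem (-(μ ^ m)⁻¹) hmem)
    have heq : T (f m) - T (f n)
        = μ ^ m • (f m - -(μ ^ m)⁻¹ • (T (f m) - μ ^ m • f m - T (f n))) := by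
      rw [smul_sub, smul_smul, mul_neg, mul_inv_cancel₀ h0]
      simp only [neg_smul, one_smul]
      abel
    rw [dist_eq_norm, heq, norm_smul]
    have h1 : 1 ≤ ‖μ ^ m‖ := by
      rw [norm_pow]
      exact one_le_pow₀ hle
    nlinarith
  obtain ⟨K, hK, hTK⟩ := hT.image_closedBall_subset_compact 1
  obtain ⟨x, -, σ, hσ, hx⟩ := hK.tendsto_subseq (x := fun n => T (f n))
    fun n => hTK ⟨f n, by simp [hf1], rfl⟩
  obtain ⟨N, hN⟩ := Metric.cauchySeq_iff.1 hx.cauchySeq (1 / 2) (by norm_num)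
  exact (hN N le_rfl (N + 1) N.le_succ).not_ge (hsep _ _ (hσ N.lt_succ_self))

/-! ### Higher derivatives of compositions and powers at a point -/

open scoped ContDiff in
/-- The leading term of Faà di Bruno's formula at a fixed point `c` of `h`: if `g` vanishes to
order `n` at `c`, then `(g ∘ h)⁽ⁿ⁾(c) = h'(c) ^ n * g⁽ⁿ⁾(c)`. -/
theorem iteratedDerivWithin_comp_of_forall_lt_eq_zero {s : Set ℝ} (hs : UniqueDiffOn ℝ s)
    {h : ℝ → ℝ} (hh : ContDiffOn ℝ ∞ h s) (hmaps : Set.MapsTo h s s) {c : ℝ} (hc : c ∈ s)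
    (hfix : h c = c) (n : ℕ) (g : ℝ → ℂ) (hg : ContDiffOn ℝ ∞ g s)
    (hzero : ∀ k < n, iteratedDerivWithin k g s c = 0) :
    iteratedDerivWithin n (g ∘ h) s c
      = ((derivWithin h s c : ℝ) : ℂ) ^ n * iteratedDerivWithin n g s c := by
  induction n using Nat.strong_induction_on generalizing g with
  | _ n ih =>
  cases n with
  | zero => simp [hfix]
  | succ n =>
    have hg' : ContDiffOn ℝ ∞ (derivWithin g s) s := hg.derivWithin hs (by simp)
    have hh' : ContDiffOn ℝ ∞ (fun x => ((derivWithin h s x : ℝ) : ℂ)) s :=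
      Complex.ofRealCLM.contDiff.comp_contDiffOn (hh.derivWithin hs (by simp))
    have hz : ∀ k < n, iteratedDerivWithin k (derivWithin g s) s c = 0 := fun k hk => by
      rw [← iteratedDerivWithin_succ']
      exact hzero _ (by omega)
    have hchain : Set.EqOn (derivWithin (g ∘ h) s)
        ((derivWithin g s ∘ h) * fun x => ((derivWithin h s x : ℝ) : ℂ)) s := fun x hx => by
      have h1 := (hg.differentiableOn (by simp) (h x) (hmaps hx)).hasDerivWithinAt
      have h2 := (hh.differentiableOn (by simp) x hx).hasDerivWithinAt
      rw [(h1.scomp x h2 hmaps).derivWithin (hs x hx)]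
      simp [mul_comm]
    have hle : ((n : ℕ∞) : WithTop ℕ∞) ≤ ∞ := by exact_mod_cast le_top
    -- Leibniz on (g' ∘ h) * h'. Since g' vanishes to order n at c, induction applied to g' kills
    -- every term in which g' ∘ h is differentiated fewer than n times; in the remaining term h' is
    -- not differentiated.
    rw [iteratedDerivWithin_succ', iteratedDerivWithin_congr hchain hc,
      iteratedDerivWithin_mul hc hs (((hg'.comp hh hmaps) c hc).of_le hle) ((hh' c hc).of_le hle),
      Finset.sum_range_succ, Finset.sum_eq_zero, ih n n.lt_succ_self _ hg' hz,
      iteratedDerivWithin_succ' (f := g)]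
    · simp
      ring
    · intro i hi
      have hi' : i < n := Finset.mem_range.1 hi
      rw [ih i (by omega) _ hg' fun k hk => hz k (by omega), hz i hi']
      simp

theorem iteratedDerivWithin_sub_pow {s : Set ℝ} (hs : UniqueDiffOn ℝ s) {c : ℝ} (hc : c ∈ s)
    (n k : ℕ) : iteratedDerivWithin k (fun x : ℝ => ((x : ℂ) - c) ^ n) s c
      = if k = n then (n.factorial : ℂ) else 0 := by
  induction k generalizing n with
  | zero => cases n <;> simp
  | succ k ih =>
    -- For n = 0 the truncated exponent n - 1 is harmless, as the factor n vanishes.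
    have hd : Set.EqOn (derivWithin (fun x : ℝ => ((x : ℂ) - c) ^ n) s)
        (fun x => (n : ℂ) * ((x : ℂ) - c) ^ (n - 1)) s := fun x hx => by
      have h1 : HasDerivAt (fun x : ℝ => (x : ℂ) - c) 1 x :=
        (Complex.ofRealCLM.hasDerivAt (x := x)).sub_const (c : ℂ)
      simpa using (h1.fun_pow n).hasDerivWithinAt.derivWithin (hs x hx)
    rw [iteratedDerivWithin_succ', iteratedDerivWithin_congr hd hc,
      iteratedDerivWithin_const_mul_field, ih]
    cases n with
    | zero => simp
    | succ n => simp [Nat.factorial_succ]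

namespace WeightedSmooth

open Set (Icc IccExtend)
open scoped ContDiff

variable {a b : ℝ}

/-! ### The coordinate function and smoothness of φ -/

/-- Values of φ already lie in [a, b], where the clamping in `IccExtend` is the identity. -/
theorem iccExtend_comp (hab : a < b) (f : Icc a b → ℂ) (φ : Icc a b → Icc a b) :
    IccExtend hab.le (f ∘ φ) = IccExtend hab.le f ∘ IccExtend hab.le fun x => (φ x : ℝ) := by
  funext x
  simp [IccExtend]

theorem memD_coe (hab : a < b) (W : WeightSequence) :
    MemD hab W fun x : Icc a b => ((x : ℝ) : ℂ) := by
  have hE : Set.EqOn (IccExtend hab.le fun x : Icc a b => ((x : ℝ) : ℂ)) (fun x : ℝ => (x : ℂ))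
      (Icc a b) := fun x hx => by simp [Set.IccExtend_of_mem _ _ hx]
  refine ⟨ContDiffOn.congr Complex.ofRealCLM.contDiff.contDiffOn hE,
    summable_of_ne_finset_zero (s := {0, 1}) fun n hn => ?_⟩
  obtain ⟨k, rfl⟩ : ∃ k, n = k + 2 := ⟨n - 2, by simp at hn; omega⟩
  have h1 : Set.EqOn (derivWithin (fun x : ℝ => (x : ℂ)) (Icc a b)) (fun _ => 1) (Icc a b) :=
    fun x hx => (Complex.ofRealCLM.hasDerivAt (x := x)).hasDerivWithinAt.derivWithin
      (uniqueDiffOn_Icc hab x hx)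
  have h2 : ∀ x : Icc a b, derivX hab (k + 2) (fun x : Icc a b => ((x : ℝ) : ℂ)) x = 0 := fun x => by
    rw [derivX, iteratedDerivWithin_congr hE x.2, iteratedDerivWithin_succ',
      iteratedDerivWithin_congr h1 x.2, iteratedDerivWithin_const]
    simp
  simp [supDeriv, h2]

/-- φ is the real part of the image of the coordinate function. -/
theorem InducesEnd.contDiffOn {hab : a < b} {W : WeightSequence} {φ : Icc a b → Icc a b}
    (hφ : InducesEnd hab W φ) :
    ContDiffOn ℝ ∞ (IccExtend hab.le fun x => (φ x : ℝ)) (Icc a b) :=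
  Complex.reCLM.contDiff.comp_contDiffOn (hφ _ (memD_coe hab W)).1

/-! ### The filtration by order of vanishing -/

section jets

variable (hab : a < b) (W : WeightSequence)

theorem D.smooth {hab : a < b} {W : WeightSequence} (f : D hab W) : Smooth hab f.fn := f.2.1

/-- One term of the norm series is at most its sum; this bound makes `evalDeriv` continuous. -/
theorem norm_derivX_le (n : ℕ) (x : Icc a b) (f : D hab W) :
    ‖derivX hab n f.fn x‖ ≤ W.M n * ‖f‖ := by
  refine (le_supDeriv hab f.smooth n x).trans ?_
  rw [← div_le_iff₀' (W.pos n), norm_def]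
  exact f.2.2.le_tsum n fun k _ => term_nonneg hab W k _

/-- The functional `f ↦ f⁽ⁿ⁾(x)` on `D(X, M)`. -/
noncomputable def evalDeriv (n : ℕ) (x : Icc a b) : D hab W →L[ℂ] ℂ :=
  LinearMap.mkContinuous
    { toFun := fun f => derivX hab n f.fn x
      map_add' := fun f g => iteratedDerivWithin_add x.2 (uniqueDiffOn_Icc hab)
        (f.smooth.within hab n x) (g.smooth.within hab n x)
      map_smul' := fun c f =>
        iteratedDerivWithin_const_smul_field (s := Icc a b) c (IccExtend hab.le f.fn) }
    (W.M n) (norm_derivX_le hab W n x)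

/-- The functions in `D(X, M)` that vanish to order `n` at `x`. -/
noncomputable def vanishing (x : Icc a b) (n : ℕ) : Submodule ℂ (D hab W) :=
  ⨅ k < n, (evalDeriv hab W k x).ker

variable {hab W}

theorem mem_vanishing {x : Icc a b} {n : ℕ} {f : D hab W} :
    f ∈ vanishing hab W x n ↔ ∀ k < n, derivX hab k f.fn x = 0 := by
  simp only [vanishing, Submodule.mem_iInf]
  exact Iff.rfl

theorem isClosed_vanishing (x : Icc a b) (n : ℕ) :
    IsClosed (vanishing hab W x n : Set (D hab W)) := by
  simp only [vanishing, Submodule.coe_iInf]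
  exact isClosed_iInter fun k => isClosed_iInter fun _ => (evalDeriv hab W k x).isClosed_ker

variable (hab W) in
theorem exists_mem_vanishing (x : Icc a b) (n : ℕ) :
    ∃ f : D hab W, f ∈ vanishing hab W x n ∧ f ∉ vanishing hab W x (n + 1) := by
  -- The power is taken in the algebra D(X, M), so membership is automatic.
  let p : D hab W := (⟨_, memD_coe hab W⟩ - algebraMap ℂ (D hab W) (x : ℝ)) ^ n
  have hp : p.fn = fun y : Icc a b => (((y : ℝ) : ℂ) - (x : ℝ)) ^ n := by
    exact SubmonoidClass.coe_pow (S := subalg hab W) _ _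
  have hE : Set.EqOn (IccExtend hab.le p.fn) (fun y : ℝ => ((y : ℂ) - (x : ℝ)) ^ n)
      (Icc a b) := fun y hy => by simp [hp, Set.IccExtend_of_mem _ _ hy]
  have hd : ∀ k, derivX hab k p.fn x = if k = n then (n.factorial : ℂ) else 0 := fun k => by
    rw [derivX, iteratedDerivWithin_congr hE x.2,
      iteratedDerivWithin_sub_pow (uniqueDiffOn_Icc hab) x.2]
  refine ⟨p, mem_vanishing.2 fun k hk => by rw [hd, if_neg hk.ne], fun h => ?_⟩
  have h0 := mem_vanishing.1 h n n.lt_succ_self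
  rw [hd, if_pos rfl] at h0
  exact n.factorial_ne_zero (by exact_mod_cast h0)

theorem strictAnti_vanishing (x : Icc a b) : StrictAnti (vanishing hab W x) :=
  strictAnti_nat_of_succ_lt fun n => by
    obtain ⟨f, hf, hf'⟩ := exists_mem_vanishing hab W x n
    exact SetLike.lt_iff_le_and_exists.2
      ⟨fun g hg => mem_vanishing.2 fun k hk => mem_vanishing.1 hg k (by omega), f, hf, hf'⟩

theorem derivX_inducedEnd {φ : Icc a b → Icc a b} (hφ : InducesEnd hab W φ) {x : Icc a b}
    (hx : φ x = x) {n : ℕ} {f : D hab W} (hf : f ∈ vanishing hab W x n) :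
    derivX hab n (inducedEnd hab W hφ f).fn x
      = ((derivWithin (IccExtend hab.le fun x => (φ x : ℝ)) (Icc a b) x : ℝ) : ℂ) ^ n
        * derivX hab n f.fn x := by
  change iteratedDerivWithin n (IccExtend hab.le (f.fn ∘ φ)) (Icc a b) x = _
  rw [iccExtend_comp hab]
  exact iteratedDerivWithin_comp_of_forall_lt_eq_zero (uniqueDiffOn_Icc hab) hφ.contDiffOn
    (fun y _ => (φ (Set.projIcc a b hab.le y)).2) x.2 (by simp [hx]) n _ f.smooth
    (mem_vanishing.1 hf)

end jets

end WeightedSmooth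

open WeightedSmooth in
theorem theorem1p1 (a b : ℝ) (hab : a < b) (W : WeightSequence)
    (φ : Set.Icc a b → Set.Icc a b) (hφ : WeightedSmooth.InducesEnd hab W φ)
    (hcompact : IsCompactOperator (WeightedSmooth.inducedEnd hab W hφ))
    (x₀ : Set.Icc a b) (hx₀ : φ x₀ = x₀) :
    DifferentiableWithinAt ℝ (Set.IccExtend hab.le fun x => (φ x : ℝ)) (Set.Icc a b) x₀ ∧
      |derivWithin (Set.IccExtend hab.le fun x => (φ x : ℝ)) (Set.Icc a b) x₀| < 1 := by
  refine ⟨hφ.contDiffOn.differentiableOn (by simp) x₀ x₀.2, ?_⟩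
  rw [← Real.norm_eq_abs, ← Complex.norm_real]
  have hanti : Antitone (vanishing hab W x₀) := (strictAnti_vanishing x₀).antitone
  have hinv : ∀ n, ∀ f ∈ vanishing hab W x₀ n,
      inducedEnd hab W hφ f ∈ vanishing hab W x₀ n := fun n f hf =>
    mem_vanishing.2 fun k hk => by
      rw [derivX_inducedEnd hφ hx₀ (hanti hk.le hf), mem_vanishing.1 hf k hk, mul_zero]
  refine IsCompactOperator.norm_lt_one_of_strictAnti (T := (inducedEnd hab W hφ).toLinearMap)
    hcompact (strictAnti_vanishing x₀) (isClosed_vanishing x₀) hinv fun n f hf => ?_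
  refine mem_vanishing.2 fun k hk => ?_
  change evalDeriv hab W k x₀ (inducedEnd hab W hφ f - _ • f) = 0
  rw [map_sub, map_smul]
  change derivX hab k (inducedEnd hab W hφ f).fn x₀ - _ • derivX hab k f.fn x₀ = 0
  rw [derivX_inducedEnd hφ hx₀ (hanti (Nat.lt_succ_iff.1 hk) hf)]
  -- At k = n the factors φ'(x₀)^n cancel; for k < n both terms vanish.
  rcases (Nat.lt_succ_iff.1 hk).eq_or_lt with rfl | hlt
  · rw [smul_eq_mul, sub_self]
  · rw [mem_vanishing.1 hf k hlt]
    simp
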